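/- **Setting.** A *nondeterministic $k$-OBDD* ($k$-NOBDD) over Boolean variables $x_1,\dots,x_n$ is a finite directed graph whose nodes are partitioned into levels $V_1,\dots,V_{kn+1}$, with edges only from a level to the next one, with a source $s\in V_1$ and a sink $t\in V_{kn+1}$; for some permutation $\theta=(j_1,\dots,j_n)$ of $\{1,\dots,n\}$, all nodes of level $V_{(i-1)n+m}$ ($1\le i\le k$, $1\le m\le n$) test the variable $x_{j_m}$, and each outgoing edge is labeled by a value ($0$ or $1$) of the tested variable; a node may have any number of outgoing edges with the same label. It computes the Boolean function $f$ with $f(\sigma)=1$ if and only if there is a path from $s$ to $t$ all of whose edges are consistent with $\sigma\in\{0,1\}^n$. Its width is $\max_j|V_j|$. For $k=k(n)$ and a set $C$ of functions $w:\mathbb N\to\mathbb N$, let $k\text{-}\mathrm{NOBDD}_C$ be the set of families $(f_n)_{n}$ of Boolean functions $f_n:\{0,1\}^n\to\{0,1\}$ for which there is $w\in C$ such that, for all sufficiently large $n$, $f_n$ is computed by a $k(n)$-NOBDD of width at most $w(n)$. Let $$\mathtt{const}=\{w: w \text{ is constant},\ w>20\},\quad \mathtt{polylog}=\{w: w=O(\log^z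 n)\text{ for some constant } z\},\quad \mathtt{sublinear}_\alpha=\{w: w=O(n^\alpha)\}.$$ **Corollary 4.** Let $k:\mathbb N\to\mathbb N$. All asymptotic relations and inequalities are for $n\to\infty$, that is, for all sufficiently large $n$. 1. If $k=o(n/\log n)$ and $\log n=o(k)$, then $$\lfloor k/\log_2\log_2 n\rfloor\text{-}\mathrm{NOBDD}_{\mathtt{const}}\subsetneq k\text{-}\mathrm{NOBDD}_{\mathtt{const}}.$$ 2. If $\varepsilon,\varepsilon_1>0$, $k=o(n^{1-\varepsilon})$ and $n^{\varepsilon_1}<k$, then $$\lfloor k/n^{\varepsilon_1}\rfloor\text{-}\mathrm{NOBDD}_{\mathtt{polylog}}\subsetneq k\text{-}\mathrm{NOBDD}_{\mathtt{polylog}}.$$ 3. If $0<\alpha<1/4$, $k>n^{2\alpha}(\log_2 n)^2$ and $k=o(n^{1-2\alpha}/\log_2 n)$, then $$\lfloor k/(n^{2\alpha}(\log_2 n)^2)\rfloor\text{-}\mathrm{NOBDD}_{\mathtt{sublinear}_\alpha}\subsetneq k\text{-}\mathrm{NOBDD}_{\mathtt{sublinear}_\alpha}.$$ -/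

import Mathlib

open Filter Asymptotics

/-- A nondeterministic leveled oblivious branching program over the Boolean variables
`x 0, …, x (n - 1)`.  The finite set `Node` of nodes is partitioned into the levels
`0, …, length` by `level`; all nodes of level `i < length` test the same variable `var i`.
`edge u b v` says that there is an edge from `u` to `v` labeled by "tested variable `= b`";
a node may have any number of outgoing edges with a given label.
Edges go only from one level to the next, so the graph is acyclic. -/
structure NBranchingProgram (n : ℕ) where
  Node : Type
  finite_node : Finite Node
  length : ℕ
  level : Node → Fin (length + 1)
  var : Fin length → Fin n
  edge : Node → Bool → Node → Prop
  level_of_edge : ∀ u b v, edge u b v → (level v : ℕ) = (level u : ℕ) + 1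
  source : Node
  sink : Node
  level_source : level source = 0
  level_sink : level sink = Fin.last length

namespace NBranchingProgram

variable {n : ℕ}

/-- There is a source-sink path all of whose edges are consistent with the input `x`. -/
def Accepts (P : NBranchingProgram n) (x : Fin n → Bool) : Prop :=
  ∃ p : Fin (P.length + 1) → P.Node,
    p 0 = P.source ∧ p (Fin.last P.length) = P.sink ∧
      ∀ i : Fin P.length, P.edge (p i.castSucc) (x (P.var i)) (p i.succ)

/-- `P` computes the Boolean function `g`. -/
def Computes (P : NBranchingProgram n) (g : (Fin n → Bool) → Bool) : Prop :=
  ∀ x, g x = true ↔ P.Accepts x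

/-- The width: the maximum number of nodes in a level. -/
noncomputable def width (P : NBranchingProgram n) : ℕ :=
  Finset.univ.sup fun j : Fin (P.length + 1) => Nat.card {v : P.Node // P.level v = j}

/-- `P` is a `k`-NOBDD: it consists of `k` consecutive layers of `n` levels each, and each layer
tests every variable once, in the order `θ 0, θ 1, …, θ (n - 1)`, the same for all layers. -/
def IsKNOBDD (P : NBranchingProgram n) (k : ℕ) : Prop :=
  P.length = k * n ∧
    ∃ θ : Equiv.Perm (Fin n), ∀ (i : Fin P.length) (j : Fin n),
      (j : ℕ) = (i : ℕ) % n → P.var i = θ j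

end NBranchingProgram

/-- The Boolean functions of `n` variables computed by `k`-NOBDDs of width at most `w`. -/
def kNOBDDWidth (n k w : ℕ) : Set ((Fin n → Bool) → Bool) :=
  {g | ∃ P : NBranchingProgram n, P.IsKNOBDD k ∧ P.width ≤ w ∧ P.Computes g}

/-- The class `k`-NOBDD`_C`, for `k = k(n)` and a set `C` of width functions: the families
`(f n)` of Boolean functions, `f n` in `n` variables, such that for some `w ∈ C`, for all
sufficiently large `n`, `f n` is computed by a `k(n)`-NOBDD of width at most `w(n)`. -/
def kNOBDD (k : ℕ → ℕ) (C : Set (ℕ → ℕ)) : Set ((n : ℕ) → (Fin n → Bool) → Bool) :=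
  {f | ∃ w ∈ C, ∀ᶠ n in atTop, f n ∈ kNOBDDWidth n (k n) (w n)}

/-- Constant widths (larger than `20`). -/
def constWidths : Set (ℕ → ℕ) :=
  {w | ∃ c : ℕ, 20 < c ∧ ∀ n, w n = c}

/-- Polylogarithmic widths: `w = O(log ^ z n)` for some constant `z`. -/
def polylogWidths : Set (ℕ → ℕ) :=
  {w | ∃ z : ℝ, (fun n => (w n : ℝ)) =O[atTop] fun n : ℕ => Real.logb 2 (n : ℝ) ^ z}

/-- Sublinear widths: `w = O(n ^ α)`. -/
def sublinearWidths (α : ℝ) : Set (ℕ → ℕ) :=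
  {w | (fun n => (w n : ℝ)) =O[atTop] fun n : ℕ => (n : ℝ) ^ α}

/-! The separation is a counting argument. A function with exactly `k` zeros needs only width 2 and
`k` layers, one layer to exclude each zero, and there are `(2 ^ n).choose k ≥ 2 ^ ((n - 1) * k) /
k!` such functions. Programs of width `W` with `k'` layers compute at most `n! * W ^ 2 * 2 ^ (2 * W
^ 2 * k' * n)` functions. Comparing exponents, some function separates once `k` exceeds a constant
multiple of `log n + W ^ 2 * (k' + 1)` (`exists_mem_not_mem_kNOBDDWidth`). With `k' = ⌊k / d⌋` this
holds for large `n` if `W ^ 2 = o(d)` and `log n = o(k)`. Each width class is eventually dominated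
by a single `v` with `v ^ 2 = o(d)`, so one family escapes all its widths at once
(`kNOBDD_ssubset`). -/

/-! ### Normal form of programs; monotonicity in width and layers -/

/-- Programs of width at most `w` are the same as sequences of transition relations on `Fin w`. -/
theorem mem_kNOBDDWidth_iff {n : ℕ} [NeZero n] {k w : ℕ} {g : (Fin n → Bool) → Bool} :
    g ∈ kNOBDDWidth n k w ↔
      ∃ (θ : Equiv.Perm (Fin n)) (s t : Fin w) (E : ℕ → Bool → Fin w → Fin w → Prop),
        ∀ x, g x = true ↔ ∃ p : ℕ → Fin w, p 0 = s ∧ p (k * n) = t ∧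
          ∀ i < k * n, E i (x (θ (Fin.ofNat n i))) (p i) (p (i + 1)) := by
  constructor
  · rintro ⟨P, ⟨hlen, θ, hθ⟩, hw, hg⟩
    have := P.finite_node
    have hcode : ∀ j, ∃ e : {v : P.Node // P.level v = j} → Fin w, Function.Injective e := by
      intro j
      have hj : Nat.card {v : P.Node // P.level v = j} ≤ w :=
        (Finset.le_sup (f := fun j => Nat.card {v : P.Node // P.level v = j})
          (Finset.mem_univ j)).trans hw
      exact ⟨_, ((Fin.castLE_injective hj).comp (Finite.equivFin _).injective)⟩
    choose e he using hcode
    let code : P.Node → Fin w := fun v => e (P.level v) ⟨v, rfl⟩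
    -- Codes are injective only within a level, so the relations below also record the level.
    have code_inj : ∀ u v, (P.level u : ℕ) = P.level v → code u = code v → u = v := by
      intro u v huv h
      have huv : P.level u = P.level v := Fin.ext huv
      have key : ∀ j (hj : P.level v = j), code v = e j ⟨v, hj⟩ := by
        rintro j rfl; rfl
      rw [key _ huv.symm] at h
      simpa using he _ h
    have hvar : ∀ i (hi : i < P.length), P.var ⟨i, hi⟩ = θ (Fin.ofNat n i) :=
      fun i hi => hθ ⟨i, hi⟩ _ rfl
    refine ⟨θ, code P.source, code P.sink,
      fun i b u v => ∃ y z, (P.level y : ℕ) = i ∧ P.edge y b z ∧ code y = u ∧ code z = v, ?_⟩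
    intro x
    rw [hg x, ← hlen]
    constructor
    · rintro ⟨p, h0, h1, hp⟩
      have hlev : ∀ i (hi : i < P.length + 1), (P.level (p ⟨i, hi⟩) : ℕ) = i := by
        intro i
        induction i with
        | zero => intro hi; simp [show (⟨0, hi⟩ : Fin (P.length + 1)) = 0 from rfl, h0,
            P.level_source]
        | succ i ih =>
          intro hi
          have := P.level_of_edge _ _ _ (hp ⟨i, by omega⟩)
          simpa [ih (by omega)] using this
      refine ⟨fun i => code (p (Fin.ofNat _ i)), by simp [h0], ?_, ?_⟩
      · rw [← h1]
        simp
      · intro i hi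
        have hi' : i < P.length + 1 := by omega
        have e1 : Fin.ofNat (P.length + 1) i = ⟨i, hi'⟩ := by
          ext; simp [Nat.mod_eq_of_lt hi']
        have e2 : Fin.ofNat (P.length + 1) (i + 1) = ⟨i + 1, by omega⟩ := by
          ext; simp [Nat.mod_eq_of_lt (show i + 1 < P.length + 1 by omega)]
        refine ⟨p ⟨i, hi'⟩, p ⟨i + 1, by omega⟩, hlev _ _, ?_,
          by dsimp only; rw [e1], by dsimp only; rw [e2]⟩
        rw [← hvar i hi]
        exact hp ⟨i, hi⟩
    · rintro ⟨p, h0, h1, hp⟩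
      have hnode : ∀ i : Fin (P.length + 1), ∃ y, (P.level y : ℕ) = i ∧ code y = p i := by
        intro i
        -- The last level has no outgoing transition to supply a node; there the sink serves.
        rcases Nat.lt_succ_iff_lt_or_eq.1 i.2 with hi | hi
        · obtain ⟨y, z, hy, -, hc, -⟩ := hp i hi
          exact ⟨y, hy, hc⟩
        · exact ⟨P.sink, by rw [P.level_sink, hi]; rfl, by rw [hi, h1]⟩
      choose q hq hqc using hnode
      refine ⟨q, code_inj _ _ ?_ ?_, code_inj _ _ ?_ ?_, ?_⟩
      · rw [hq, P.level_source]
      · rw [hqc]; exact h0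
      · rw [hq, P.level_sink]
      · rw [hqc]; exact h1
      · intro i
        obtain ⟨y, z, hy, hyz, hyc, hzc⟩ := hp i i.2
        have hz := P.level_of_edge _ _ _ hyz
        have e1 : q i.castSucc = y := code_inj _ _ (by rw [hq, hy]; rfl) (by rw [hqc, hyc]; rfl)
        have e2 : q i.succ = z := code_inj _ _ (by rw [hq, hz, hy]; rfl) (by rw [hqc, hzc]; rfl)
        rw [e1, e2, hvar i i.2]
        exact hyz
  · rintro ⟨θ, s, t, E, hE⟩
    refine ⟨{ Node := Fin (k * n + 1) × Fin w
              finite_node := inferInstance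
              length := k * n
              level := Prod.fst
              var := fun i => θ (Fin.ofNat n i)
              edge := fun u b v => (v.1 : ℕ) = u.1 + 1 ∧ E u.1 b u.2 v.2
              level_of_edge := fun _ _ _ h => h.1
              source := (0, s)
              sink := (Fin.last _, t)
              level_source := rfl
              level_sink := rfl }, ⟨rfl, θ, ?_⟩, ?_, ?_⟩
    · intro i j hij
      change θ _ = θ _
      congr 1
      ext
      simp [hij]
    · refine Finset.sup_le fun j _ => ?_
      have hinj : Function.Injective
          (fun v : {v : Fin (k * n + 1) × Fin w // v.1 = j} => v.1.2) := by
        rintro ⟨u, hu⟩ ⟨v, hv⟩ h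
        exact Subtype.ext (Prod.ext (hu.trans hv.symm) h)
      simpa using Nat.card_le_card_of_injective _ hinj
    · intro x
      rw [hE x]
      constructor
      · rintro ⟨p, h0, h1, hp⟩
        refine ⟨fun i => (i, p i), ?_, ?_, ?_⟩
        · exact Prod.ext rfl h0
        · exact Prod.ext rfl h1
        · exact fun i => ⟨rfl, hp i i.2⟩
      · rintro ⟨p, h0, h1, hp⟩
        dsimp only at p h0 h1 hp
        have hlev : ∀ i (hi : i < k * n + 1), ((p ⟨i, hi⟩).1 : ℕ) = i := by
          intro i
          induction i with
          | zero => intro hi; simp [show (⟨0, hi⟩ : Fin (k * n + 1)) = 0 from rfl, h0]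
          | succ i ih =>
            intro hi
            have := (hp ⟨i, by omega⟩).1
            simpa [ih (by omega)] using this
        have hof : ∀ i (hi : i < k * n + 1), Fin.ofNat (k * n + 1) i = ⟨i, hi⟩ := by
          intro i hi
          ext; simp [Nat.mod_eq_of_lt hi]
        refine ⟨fun i => (p (Fin.ofNat _ i)).2, by simp [h0], ?_, ?_⟩
        · dsimp only
          rw [hof _ (Nat.lt_succ_self _)]
          exact congrArg Prod.snd h1
        · intro i hi
          have := (hp ⟨i, hi⟩).2
          dsimp only
          rw [hof i (by omega), hof (i + 1) (by omega)]
          change E ((p ⟨i, by omega⟩).1 : ℕ) _ _ _ at this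
          rw [hlev] at this
          exact this

theorem kNOBDDWidth_mono_width {n k w w' : ℕ} (h : w ≤ w') :
    kNOBDDWidth n k w ⊆ kNOBDDWidth n k w' :=
  fun _ ⟨P, hP, hw, hg⟩ => ⟨P, hP, hw.trans h, hg⟩

/-- Further layers may be added: they let a single path through, starting from the old sink. -/
theorem kNOBDDWidth_mono_layers {n : ℕ} [NeZero n] {k k' w : ℕ} (h : k' ≤ k) :
    kNOBDDWidth n k' w ⊆ kNOBDDWidth n k w := by
  intro g hg
  obtain ⟨θ, s, t, E, hE⟩ := mem_kNOBDDWidth_iff.1 hg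
  have hkn : k' * n ≤ k * n := Nat.mul_le_mul_right n h
  refine mem_kNOBDDWidth_iff.2
    ⟨θ, s, t, fun i b u v => if i < k' * n then E i b u v else u = t ∧ v = t, fun x => ?_⟩
  rw [hE x]
  constructor
  · rintro ⟨p, h0, h1, hp⟩
    refine ⟨fun i => if i ≤ k' * n then p i else t, by simpa using h0, ?_, ?_⟩
    · dsimp only
      split_ifs with hle
      · rw [le_antisymm hkn hle] at h1
        exact h1
      · rfl
    · intro i _
      dsimp only
      by_cases hi : i < k' * n
      · rw [if_pos hi, if_pos hi.le, if_pos (Nat.succ_le_of_lt hi)]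
        exact hp i hi
      · rw [if_neg hi, if_neg (show ¬ i + 1 ≤ k' * n by omega)]
        refine ⟨?_, rfl⟩
        split_ifs with hle
        · rw [show i = k' * n by omega, h1]
        · rfl
  · rintro ⟨p, h0, h1, hp⟩
    refine ⟨p, h0, ?_, fun i hi => by simpa [hi] using hp i (hi.trans_le hkn)⟩
    rcases hkn.eq_or_lt with heq | hlt
    · rw [heq, h1]
    · have := hp _ hlt
      simp only [lt_irrefl, if_false] at this
      exact this.1

/-! ### Counting programs against functions with `k` zeros -/

/-- There are at most as many functions as there are codes for programs. -/
theorem ncard_kNOBDDWidth_le (n : ℕ) [NeZero n] (k w : ℕ) :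
    (kNOBDDWidth n k w).ncard ≤ n.factorial * (w * (w * 2 ^ (2 * w ^ 2 * (k * n)))) := by
  classical
  let F : Equiv.Perm (Fin n) × Fin w × Fin w × (Fin (k * n) → Bool → Fin w → Fin w → Bool) →
      (Fin n → Bool) → Bool := fun c x =>
    decide (∃ p : ℕ → Fin w, p 0 = c.2.1 ∧ p (k * n) = c.2.2.1 ∧
      ∀ i (hi : i < k * n), c.2.2.2 ⟨i, hi⟩ (x (c.1 (Fin.ofNat n i))) (p i) (p (i + 1)) = true)
  have hsub : kNOBDDWidth n k w ⊆ Set.range F := by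
    intro g hg
    obtain ⟨θ, s, t, E, hE⟩ := mem_kNOBDDWidth_iff.1 hg
    refine ⟨⟨θ, s, t, fun i b u v => decide (E i b u v)⟩, funext fun x => ?_⟩
    rw [Bool.eq_iff_iff, hE x]
    simp [F]
  calc (kNOBDDWidth n k w).ncard ≤ (Set.range F).ncard :=
        Set.ncard_le_ncard hsub (Set.toFinite _)
    _ ≤ Nat.card (Equiv.Perm (Fin n) × Fin w × Fin w ×
          (Fin (k * n) → Bool → Fin w → Fin w → Bool)) := by
        rw [← Set.image_univ, ← Set.ncard_univ]
        exact Set.ncard_image_le (Set.toFinite _)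
    _ = n.factorial * (w * (w * 2 ^ (2 * w ^ 2 * (k * n)))) := by
        rw [Nat.card_eq_fintype_card]
        simp only [Fintype.card_prod, Fintype.card_perm, Fintype.card_fin, Fintype.card_fun,
          Fintype.card_bool, ← pow_mul]
        congr 4
        ring

/-- A function with at most `k` zeros is computed with width `2`: the layer `q` checks that the
input differs from the zero `a q`. -/
theorem mem_kNOBDDWidth_of_zeros {n : ℕ} [NeZero n] {k : ℕ} (a : ℕ → Fin n → Bool)
    {g : (Fin n → Bool) → Bool} (hg : ∀ x, g x = true ↔ ∀ q < k, x ≠ a q) :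
    g ∈ kNOBDDWidth n k 2 := by
  have hn : 0 < n := Nat.pos_of_ne_zero (NeZero.ne n)
  -- State 1 certifies a difference from `a (i / n)` seen in the current layer. The last transition
  -- of a layer requires such a difference and resets to 0. Elsewhere falling back to 0 is always
  -- allowed, which only loses information.
  refine mem_kNOBDDWidth_iff.2 ⟨1, 0, 0, fun i b u v =>
    (u = 1 ∨ b ≠ a (i / n) (Fin.ofNat n i)) ∧ i % n + 1 = n ∧ v = 0 ∨
    i % n + 1 ≠ n ∧ (v = 1 → u = 1 ∨ b ≠ a (i / n) (Fin.ofNat n i)), fun x => ?_⟩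
  rw [hg x]
  simp only [Equiv.Perm.coe_one, id_eq]
  have hmod : ∀ q m, m < n → (q * n + m) % n = m := fun q m hm => by
    rw [add_comm, Nat.add_mul_mod_self_right, Nat.mod_eq_of_lt hm]
  have hdiv : ∀ q m, m < n → (q * n + m) / n = q := fun q m hm => by
    rw [add_comm, Nat.add_mul_div_right _ _ hn, Nat.div_eq_of_lt hm, zero_add]
  constructor
  · intro h
    classical
    refine ⟨fun i => if ∃ j : Fin n, (j : ℕ) < i % n ∧ x j ≠ a (i / n) j then 1 else 0,
      by simp, by simp, fun i hi => ?_⟩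
    have hcur : (∃ j : Fin n, (j : ℕ) < i % n + 1 ∧ x j ≠ a (i / n) j) →
        (∃ j : Fin n, (j : ℕ) < i % n ∧ x j ≠ a (i / n) j) ∨
          x (Fin.ofNat n i) ≠ a (i / n) (Fin.ofNat n i) := by
      rintro ⟨j, hj, hne⟩
      rcases Nat.lt_succ_iff_lt_or_eq.1 hj with hlt | heq
      · exact Or.inl ⟨j, hlt, hne⟩
      · have : j = Fin.ofNat n i := Fin.ext heq
        exact Or.inr (this ▸ hne)
    by_cases hlast : i % n + 1 = n
    · refine Or.inl ⟨?_, hlast, ?_⟩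
      · obtain ⟨j, hj⟩ := Function.ne_iff.1 (h (i / n) (Nat.div_lt_of_lt_mul (by rwa [mul_comm])))
        refine (hcur ⟨j, j.2.trans_eq hlast.symm, hj⟩).imp_left fun hh => if_pos hh
      · refine if_neg ?_
        have : (i + 1) % n = 0 := by
          have hi1 : i + 1 = (i / n + 1) * n := by
            conv_lhs => rw [← Nat.div_add_mod' i n, add_assoc, hlast]
            ring
          rw [hi1, Nat.mul_mod_left]
        simp [this]
    · refine Or.inr ⟨hlast, fun hv => ?_⟩
      have hm : i % n + 1 < n := lt_of_le_of_ne (Nat.mod_lt i hn) hlast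
      have hi1 : i + 1 = i / n * n + (i % n + 1) := by
        rw [← add_assoc, Nat.div_add_mod']
      dsimp only at hv ⊢
      rw [hi1, hmod _ _ hm, hdiv _ _ hm] at hv
      refine (hcur ?_).imp_left fun hh => if_pos hh
      by_contra hcon
      rw [if_neg hcon] at hv
      exact absurd hv (by decide)
  · rintro ⟨p, h0, h1, hp⟩ q hq rfl
    have hstart : p (q * n) = 0 := by
      rcases Nat.eq_zero_or_pos q with rfl | hq0
      · simpa using h0
      · obtain ⟨r, rfl⟩ := Nat.exists_eq_succ_of_ne_zero hq0.ne'
        have hr := hp (r * n + (n - 1)) (by nlinarith [Nat.sub_add_cancel hn])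
        rw [hmod _ _ (by omega)] at hr
        rcases hr with hr | hr
        · rw [Nat.succ_mul, ← hr.2.2]
          congr 1; omega
        · omega
    -- On the input `a q` no difference ever appears in layer `q`, so its last transition is
    -- blocked.
    have hblock : ∀ m < n, p (q * n + m) = 0 := by
      intro m
      induction m with
      | zero => exact fun _ => hstart
      | succ m ih =>
        intro hm
        have hlt : q * n + m < k * n := by nlinarith
        have hs := hp (q * n + m) hlt
        rw [hmod _ _ (by omega), hdiv _ _ (by omega), ih (by omega)] at hs
        rcases hs with hs | hs
        · omega
        · by_contra hne
          have : p (q * n + m + 1) = 1 := by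
            have h2 : p (q * n + m + 1) ≠ 0 := hne
            revert h2
            generalize p (q * n + m + 1) = z
            revert z
            decide
          simpa using hs.2 this
    have hs := hp (q * n + (n - 1)) (by nlinarith [Nat.sub_add_cancel hn])
    rw [hmod _ _ (by omega), hdiv _ _ (by omega), hblock _ (by omega)] at hs
    rcases hs with hs | hs
    · simpa using hs.1
    · omega

/-- If there are more `k`-element sets of inputs than codes for `k'`-NOBDDs of width `W`, some
function is computed by a `k`-NOBDD of width `2`, but by no `k'`-NOBDD of width `W`. -/
theorem exists_mem_not_mem_kNOBDDWidth {n k k' L W : ℕ} (hn : 2 ≤ n) (hL : n ≤ 2 ^ L) (hkn : k ≤ n)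
    (h : 4 * L + 4 * W ^ 2 * (k' + 1) < k) :
    ∃ g, g ∈ kNOBDDWidth n k 2 ∧ g ∉ kNOBDDWidth n k' W := by
  classical
  have : NeZero n := ⟨by omega⟩
  by_contra! hsub
  let S : Finset (Finset (Fin n → Bool)) := Finset.univ.powersetCard k
  let G : Finset (Fin n → Bool) → (Fin n → Bool) → Bool := fun T x => decide (x ∉ T)
  have hG : Function.Injective G := by
    intro T T' hTT
    ext x
    have := congrFun hTT x
    simp only [G, decide_eq_decide] at this
    tauto
  have hmem : ∀ T ∈ S, G T ∈ kNOBDDWidth n k 2 := by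
    intro T hT
    have hcard : T.card = k := (Finset.mem_powersetCard.1 hT).2
    let e := (T.equivFinOfCardEq hcard).symm
    refine mem_kNOBDDWidth_of_zeros
      (fun q => if hq : q < k then (e ⟨q, hq⟩ : Fin n → Bool) else default) fun x => ?_
    simp only [G, decide_eq_true_eq]
    constructor
    · rintro hx q hq rfl
      simp [hq] at hx
    · intro hx hxT
      refine hx (e.symm ⟨x, hxT⟩) (e.symm ⟨x, hxT⟩).2 ?_
      simp
  have hcount : Nat.choose (2 ^ n) k ≤ n.factorial * (W * (W * 2 ^ (2 * W ^ 2 * (k' * n)))) := by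
    calc Nat.choose (2 ^ n) k = (S.image G).card := by
          rw [Finset.card_image_of_injective _ hG, Finset.card_powersetCard]
          simp
      _ = (↑(S.image G) : Set ((Fin n → Bool) → Bool)).ncard := (Set.ncard_coe_finset _).symm
      _ ≤ (kNOBDDWidth n k' W).ncard := by
          refine Set.ncard_le_ncard ?_ (Set.toFinite _)
          intro g hg
          obtain ⟨T, hT, rfl⟩ := Finset.mem_image.1 (Finset.mem_coe.1 hg)
          exact hsub _ (hmem T hT)
      _ ≤ _ := ncard_kNOBDDWidth_le n k' W
  have hpow : 2 ^ ((n - 1) * k) ≤ 2 ^ (L * n) * Nat.choose (2 ^ n) k := by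
    -- Lower bound for the smallest factor of the falling factorial, using `k ≤ n ≤ 2 ^ (n - 1)`.
    have h1 : 2 ^ (n - 1) ≤ 2 ^ n + 1 - k := by
      have h2 : n - 1 < 2 ^ (n - 1) := Nat.lt_two_pow_self
      have h3 : 2 ^ n = 2 ^ (n - 1) * 2 := by rw [← pow_succ, Nat.sub_add_cancel (by omega)]
      omega
    calc 2 ^ ((n - 1) * k) = (2 ^ (n - 1)) ^ k := pow_mul _ _ _
      _ ≤ (2 ^ n + 1 - k) ^ k := Nat.pow_le_pow_left h1 k
      _ ≤ (2 ^ n).descFactorial k := Nat.pow_sub_le_descFactorial _ _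
      _ = k.factorial * Nat.choose (2 ^ n) k := Nat.descFactorial_eq_factorial_mul_choose _ _
      _ ≤ 2 ^ (L * n) * Nat.choose (2 ^ n) k := by
        refine Nat.mul_le_mul_right _ ?_
        calc k.factorial ≤ n.factorial := Nat.factorial_le hkn
          _ ≤ n ^ n := Nat.factorial_le_pow n
          _ ≤ (2 ^ L) ^ n := Nat.pow_le_pow_left hL n
          _ = 2 ^ (L * n) := (pow_mul _ _ _).symm
  have hfact : n.factorial ≤ 2 ^ (L * n) := by
    rw [pow_mul]
    exact (Nat.factorial_le_pow n).trans (Nat.pow_le_pow_left hL n)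
  have hW : W ≤ 2 ^ W := Nat.lt_two_pow_self.le
  have htotal : 2 ^ ((n - 1) * k) ≤ 2 ^ (L * n + (L * n + (W + (W + 2 * W ^ 2 * (k' * n))))) := by
    refine hpow.trans ?_
    rw [pow_add, pow_add, pow_add, pow_add]
    gcongr
    refine hcount.trans ?_
    gcongr
  have hexp := (Nat.pow_le_pow_iff_right (by norm_num)).1 htotal
  obtain ⟨m, rfl⟩ : ∃ m, n = m + 1 := ⟨n - 1, by omega⟩
  -- This absorbs the source and sink choices into the `+ 1` of `k' + 1`. The exponent bound becomes
  -- `m * k ≤ (m + 1) * (2 * L + 2 * W ^ 2 * (k' + 1)) < (m + 1) * k / 2`, impossible as `m + 1 ≤ 2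
  -- * m`.
  have hWW : W ≤ W ^ 2 * (m + 1) := by nlinarith [Nat.zero_le (W ^ 2 * m), Nat.le_self_pow two_ne_zero W]
  simp only [Nat.add_sub_cancel] at hexp
  have hm : 1 ≤ m := by omega
  have hmul := Nat.mul_lt_mul_of_pos_right h (show 0 < m + 1 by omega)
  nlinarith

/-! ### Asymptotic estimates and the general separation -/

theorem tendsto_logb_two_natCast : Tendsto (fun n : ℕ => Real.logb 2 (n : ℝ)) atTop atTop :=
  (Real.tendsto_logb_atTop one_lt_two).comp tendsto_natCast_atTop_atTop

theorem isLittleO_logb_rpow_rpow (z : ℝ) {r : ℝ} (hr : 0 < r) :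
    (fun n : ℕ => Real.logb 2 (n : ℝ) ^ z) =o[atTop] fun n : ℕ => (n : ℝ) ^ r := by
  have h := ((isLittleO_log_rpow_rpow_atTop z hr).comp_tendsto
    tendsto_natCast_atTop_atTop).const_mul_left (((Real.log 2) ^ z)⁻¹)
  refine h.congr' ?_ (EventuallyEq.refl _ _)
  filter_upwards [eventually_ge_atTop 1] with n hn
  have h0 : 0 ≤ Real.log n := Real.log_natCast_nonneg n
  simp only [Function.comp, Real.logb]
  rw [Real.div_rpow h0 (Real.log_nonneg one_le_two)]
  ring

theorem isLittleO_logb_rpow {r : ℝ} (hr : 0 < r) :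
    (fun n : ℕ => Real.logb 2 (n : ℝ)) =o[atTop] fun n : ℕ => (n : ℝ) ^ r := by
  simpa using isLittleO_logb_rpow_rpow 1 hr

/-- Supplies a dominating width `v = d ^ (1 / 4)`: it is unbounded, yet its square is only `d ^ (1 /
2)`. -/
theorem isLittleO_rpow_quarter_sq {d : ℕ → ℝ} (hd : Tendsto d atTop atTop) :
    (fun n => (d n ^ (1 / 4 : ℝ)) ^ 2) =o[atTop] d := by
  have hroot : Tendsto (fun n => d n ^ (1 / 4 : ℝ)) atTop atTop :=
    (tendsto_rpow_atTop (by norm_num)).comp hd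
  have h := (isLittleO_pow_pow_atTop_of_lt (𝕜 := ℝ) (show 2 < 4 by norm_num)).comp_tendsto hroot
  refine h.congr' (EventuallyEq.refl _ _) ?_
  filter_upwards [hd.eventually_ge_atTop 0] with n hn
  simp only [Function.comp]
  rw [← Real.rpow_mul_natCast hn]
  norm_num

theorem eventually_le_of_isLittleO {f g : ℕ → ℝ} (h : f =o[atTop] g) (hg : ∀ᶠ n in atTop, 0 ≤ g n)
    {c : ℝ} (hc : 0 < c) : ∀ᶠ n in atTop, f n ≤ c * g n := by
  filter_upwards [h.def hc, hg] with n hn hgn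
  rw [Real.norm_of_nonneg hgn] at hn
  exact (le_abs_self _).trans hn

/-- Diagonalization over `C`: for each large `n` pick a function that is hard for width `⌊v n⌋₊`.
Since `v` eventually dominates every member of `C`, this one family defeats them all, while width 2
fits within the constant 21. -/
theorem kNOBDD_ssubset {C : Set (ℕ → ℕ)} {k : ℕ → ℕ} {d v : ℕ → ℝ}
    (hC : (fun _ => 21) ∈ C) (hv : ∀ w ∈ C, ∀ᶠ n in atTop, (w n : ℝ) ≤ v n)
    (hvd : (fun n => v n ^ 2) =o[atTop] d) (hd : ∀ᶠ n in atTop, 1 ≤ d n)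
    (hdk : ∀ᶠ n in atTop, d n ≤ k n) (hkn : ∀ᶠ n in atTop, (k n : ℝ) ≤ n)
    (hlog : (fun n : ℕ => Real.logb 2 (n : ℝ)) =o[atTop] fun n => (k n : ℝ)) :
    kNOBDD (fun n => ⌊(k n : ℝ) / d n⌋₊) C ⊂ kNOBDD k C := by
  classical
  have hv0 : ∀ᶠ n in atTop, 0 ≤ v n := by
    filter_upwards [hv _ hC] with n hn
    exact (Nat.cast_nonneg _).trans hn
  have hsep : ∀ᶠ n in atTop, ∃ g, g ∈ kNOBDDWidth n (k n) 2 ∧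
      g ∉ kNOBDDWidth n ⌊(k n : ℝ) / d n⌋₊ ⌊v n⌋₊ := by
    filter_upwards [eventually_ge_atTop 2, hv0, hd, hdk, hkn,
      tendsto_logb_two_natCast.eventually_ge_atTop 1,
      eventually_le_of_isLittleO hvd (hd.mono fun n h => zero_le_one.trans h)
        (show (0 : ℝ) < 1 / 32 by norm_num),
      eventually_le_of_isLittleO hlog (Eventually.of_forall fun n => Nat.cast_nonneg _)
        (show (0 : ℝ) < 1 / 16 by norm_num)] with n hn hv0 hd hdk hkn hl1 hvd hlog
    refine exists_mem_not_mem_kNOBDDWidth hn (Nat.le_pow_clog one_lt_two n)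
      (by exact_mod_cast hkn) ?_
    have hclog : (Nat.clog 2 n : ℝ) ≤ Real.logb 2 n + 1 := by
      rw [← Real.natCeil_logb_natCast]
      exact_mod_cast (Nat.ceil_lt_add_one (zero_le_one.trans hl1)).le
    have hd0 : 0 < d n := zero_lt_one.trans_le hd
    have hW : (⌊v n⌋₊ : ℝ) ^ 2 ≤ 1 / 32 * d n :=
      (pow_le_pow_left₀ (Nat.cast_nonneg _) (Nat.floor_le hv0) 2).trans hvd
    have hκ : (⌊(k n : ℝ) / d n⌋₊ : ℝ) + 1 ≤ 2 * (k n / d n) := by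
      have h1 : 1 ≤ (k n : ℝ) / d n := (one_le_div hd0).2 hdk
      have h2 : (⌊(k n : ℝ) / d n⌋₊ : ℝ) ≤ k n / d n := Nat.floor_le (zero_le_one.trans h1)
      linarith
    have hprod : (⌊v n⌋₊ : ℝ) ^ 2 * ((⌊(k n : ℝ) / d n⌋₊ : ℝ) + 1) ≤ k n / 16 := by
      calc _ ≤ 1 / 32 * d n * (2 * (k n / d n)) := by gcongr
        _ = k n / 16 := by field_simp; ring
    -- The first summand is at most `k / 4 + 4` and the second at most `k / 4`; `1 ≤ logb 2 n ≤ k /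
    -- 16` gives `k ≥ 16`.
    have : (4 * Nat.clog 2 n + 4 * ⌊v n⌋₊ ^ 2 * (⌊(k n : ℝ) / d n⌋₊ + 1) : ℝ) < k n := by
      linarith
    exact_mod_cast this
  have hsub : kNOBDD (fun n => ⌊(k n : ℝ) / d n⌋₊) C ⊆ kNOBDD k C := by
    rintro f ⟨w, hw, hf⟩
    refine ⟨w, hw, ?_⟩
    filter_upwards [hf, hd, eventually_ge_atTop 1] with n hfn hdn hn
    have : NeZero n := ⟨by omega⟩
    refine kNOBDDWidth_mono_layers ?_ hfn
    exact Nat.floor_le_of_le (div_le_self (Nat.cast_nonneg _) hdn)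
  refine ⟨hsub, fun hsup => ?_⟩
  let f : (n : ℕ) → (Fin n → Bool) → Bool := fun n =>
    if h : ∃ g, g ∈ kNOBDDWidth n (k n) 2 ∧ g ∉ kNOBDDWidth n ⌊(k n : ℝ) / d n⌋₊ ⌊v n⌋₊
    then h.choose else fun _ => false
  have hf : ∀ᶠ n in atTop, f n ∈ kNOBDDWidth n (k n) 2 ∧
      f n ∉ kNOBDDWidth n ⌊(k n : ℝ) / d n⌋₊ ⌊v n⌋₊ := by
    filter_upwards [hsep] with n hn
    simp only [f, dif_pos hn]
    exact hn.choose_spec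
  obtain ⟨w, hw, hfw⟩ :=
    hsup ⟨_, hC, hf.mono fun n hn => kNOBDDWidth_mono_width (by norm_num) hn.1⟩
  obtain ⟨n, h1, h2, h3⟩ := (hf.and (hfw.and (hv w hw))).exists
  exact h1.2 (kNOBDDWidth_mono_width (Nat.le_floor h3) h2)

/-! ### The three width classes -/

theorem corollary4 :
    (∀ k : ℕ → ℕ,
      (fun n => (k n : ℝ)) =o[atTop] (fun n : ℕ => (n : ℝ) / Real.logb 2 (n : ℝ)) →
      (fun n : ℕ => Real.logb 2 (n : ℝ)) =o[atTop] (fun n => (k n : ℝ)) →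
      kNOBDD (fun n => ⌊(k n : ℝ) / Real.logb 2 (Real.logb 2 (n : ℝ))⌋₊) constWidths
        ⊂ kNOBDD k constWidths) ∧
    (∀ (ε ε₁ : ℝ) (k : ℕ → ℕ), 0 < ε → 0 < ε₁ →
      (fun n => (k n : ℝ)) =o[atTop] (fun n : ℕ => (n : ℝ) ^ (1 - ε)) →
      (∀ᶠ n : ℕ in atTop, (n : ℝ) ^ ε₁ < (k n : ℝ)) →
      kNOBDD (fun n => ⌊(k n : ℝ) / (n : ℝ) ^ ε₁⌋₊) polylogWidths
        ⊂ kNOBDD k polylogWidths) ∧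
    (∀ (α : ℝ) (k : ℕ → ℕ), 0 < α → α < 1 / 4 →
      (∀ᶠ n : ℕ in atTop, (n : ℝ) ^ (2 * α) * Real.logb 2 (n : ℝ) ^ 2 < (k n : ℝ)) →
      (fun n => (k n : ℝ)) =o[atTop]
        (fun n : ℕ => (n : ℝ) ^ (1 - 2 * α) / Real.logb 2 (n : ℝ)) →
      kNOBDD (fun n => ⌊(k n : ℝ) / ((n : ℝ) ^ (2 * α) * Real.logb 2 (n : ℝ) ^ 2)⌋₊)
          (sublinearWidths α)
        ⊂ kNOBDD k (sublinearWidths α)) := by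
  have hlog1 := tendsto_logb_two_natCast.eventually_ge_atTop 1
  have hone : ∀ᶠ n : ℕ in atTop, (1 : ℝ) ≤ n := by
    filter_upwards [eventually_ge_atTop 1] with n hn
    exact_mod_cast hn
  refine ⟨fun k hk hlog => ?_, fun ε ε₁ k hε hε₁ hk hlow => ?_, fun α k hα _ hlow hk => ?_⟩
  · have hd : Tendsto (fun n : ℕ => Real.logb 2 (Real.logb 2 (n : ℝ))) atTop atTop :=
      (Real.tendsto_logb_atTop one_lt_two).comp tendsto_logb_two_natCast
    refine kNOBDD_ssubset (v := fun n => Real.logb 2 (Real.logb 2 (n : ℝ)) ^ (1 / 4 : ℝ))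
      ⟨21, by norm_num, fun _ => rfl⟩ ?_ (isLittleO_rpow_quarter_sq hd)
      (hd.eventually_ge_atTop 1) ?_ ?_ hlog
    · rintro w ⟨c, -, hw⟩
      filter_upwards [((tendsto_rpow_atTop (by norm_num : (0 : ℝ) < 1 / 4)).comp
        hd).eventually_ge_atTop (c : ℝ)] with n hn
      rw [hw]
      exact hn
    · have hll : (fun n : ℕ => Real.logb 2 (Real.logb 2 (n : ℝ))) =o[atTop]
          fun n : ℕ => Real.logb 2 (n : ℝ) := by
        have h := Real.isLittleO_log_id_atTop.const_mul_left (Real.log 2)⁻¹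
        refine (h.comp_tendsto tendsto_logb_two_natCast).congr (fun n => ?_) fun n => rfl
        simp only [Function.comp, Real.logb]
        ring
      simpa using eventually_le_of_isLittleO (hll.trans hlog)
        (Eventually.of_forall fun n => Nat.cast_nonneg _) one_pos
    · filter_upwards [eventually_le_of_isLittleO hk
        (hlog1.mono fun n h => div_nonneg (Nat.cast_nonneg n) (zero_le_one.trans h)) one_pos,
        hlog1] with n hn h1
      rw [one_mul] at hn
      exact hn.trans (div_le_self (Nat.cast_nonneg _) h1)
  · have hd : Tendsto (fun n : ℕ => (n : ℝ) ^ ε₁) atTop atTop :=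
      (tendsto_rpow_atTop hε₁).comp tendsto_natCast_atTop_atTop
    -- Here `v = n ^ (ε₁ / 4)`, which outgrows every power of the logarithm.
    refine kNOBDD_ssubset (v := fun n => ((n : ℝ) ^ ε₁) ^ (1 / 4 : ℝ))
      ⟨0, ?_⟩ ?_ (isLittleO_rpow_quarter_sq hd)
      (hd.eventually_ge_atTop 1) (hlow.mono fun n h => h.le) ?_ ?_
    · simpa using isBigO_const_const (21 : ℝ) (one_ne_zero (α := ℝ)) (atTop : Filter ℕ)
    · rintro w ⟨z, hw⟩
      have h := hw.trans_isLittleO (isLittleO_logb_rpow_rpow z (r := ε₁ * (1 / 4)) (by positivity))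
      filter_upwards [eventually_le_of_isLittleO h
        (Eventually.of_forall fun n => Real.rpow_nonneg (Nat.cast_nonneg _) _) one_pos] with n hn
      rwa [one_mul, Real.rpow_mul (Nat.cast_nonneg _)] at hn
    · filter_upwards [eventually_le_of_isLittleO hk
        (Eventually.of_forall fun n => Real.rpow_nonneg (Nat.cast_nonneg _) _) one_pos,
        hone] with n hn h1
      rw [one_mul] at hn
      exact hn.trans ((Real.rpow_le_rpow_of_exponent_le h1 (by linarith)).trans_eq
        (Real.rpow_one _))
    · refine (isLittleO_logb_rpow hε₁).trans_isBigO (IsBigO.of_bound 1 ?_)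
      filter_upwards [hlow] with n hn
      rw [one_mul, Real.norm_of_nonneg (Real.rpow_nonneg (Nat.cast_nonneg _) _), RCLike.norm_natCast]
      exact hn.le
  · have hpow : ∀ {r : ℝ}, 0 < r → Tendsto (fun n : ℕ => (n : ℝ) ^ r) atTop atTop := fun hr =>
      (tendsto_rpow_atTop hr).comp tendsto_natCast_atTop_atTop
    have h2α : 0 < 2 * α := by positivity
    have hle : ∀ᶠ n : ℕ in atTop,
        (n : ℝ) ^ (2 * α) ≤ (n : ℝ) ^ (2 * α) * Real.logb 2 (n : ℝ) ^ 2 := by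
      filter_upwards [hlog1] with n h1
      exact le_mul_of_one_le_right (Real.rpow_nonneg (Nat.cast_nonneg _) _) (one_le_pow₀ h1)
    -- The factor `log ^ (1 / 2)` beats the implied constant of any `O(n ^ α)`, and `v ^ 2 = n ^ (2
    -- * α) * log` stays a factor `log` below `d`.
    refine kNOBDD_ssubset (v := fun n => (n : ℝ) ^ α * Real.logb 2 (n : ℝ) ^ (1 / 2 : ℝ))
      ?_ ?_ ?_ ?_ (hlow.mono fun n h => h.le) ?_ ?_
    · refine IsBigO.of_bound 21 ?_
      filter_upwards [(hpow hα).eventually_ge_atTop 1] with n hn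
      rw [Real.norm_of_nonneg (zero_le_one.trans hn)]
      norm_num
      exact hn
    · intro w hw
      have h : (fun n : ℕ => (n : ℝ) ^ α * 1) =o[atTop]
          fun n : ℕ => (n : ℝ) ^ α * Real.logb 2 (n : ℝ) ^ (1 / 2 : ℝ) := by
        refine (isBigO_refl _ _).mul_isLittleO ?_
        refine (isLittleO_const_left.2 (Or.inr ?_))
        exact tendsto_norm_atTop_atTop.comp
          ((tendsto_rpow_atTop (by norm_num : (0 : ℝ) < 1 / 2)).comp tendsto_logb_two_natCast)
      simp only [mul_one] at h
      simpa using eventually_le_of_isLittleO (IsBigO.trans_isLittleO hw h) (hlog1.mono fun n h1 =>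
        mul_nonneg (Real.rpow_nonneg (Nat.cast_nonneg _) _)
          (Real.rpow_nonneg (zero_le_one.trans h1) _)) one_pos
    · have h : (fun n : ℕ => (n : ℝ) ^ (2 * α) * Real.logb 2 (n : ℝ)) =o[atTop]
          fun n : ℕ => (n : ℝ) ^ (2 * α) * Real.logb 2 (n : ℝ) ^ 2 := by
        refine (isBigO_refl _ _).mul_isLittleO ?_
        exact ((isLittleO_pow_pow_atTop_of_lt (𝕜 := ℝ) one_lt_two).comp_tendsto
          tendsto_logb_two_natCast).congr_left fun n => by simp
      refine h.congr' ?_ (EventuallyEq.refl _ _)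
      filter_upwards [hlog1] with n h1
      rw [mul_pow, ← Real.rpow_mul_natCast (Nat.cast_nonneg _),
        ← Real.rpow_mul_natCast (zero_le_one.trans h1)]
      norm_num [mul_comm]
    · filter_upwards [hle, (hpow h2α).eventually_ge_atTop 1] with n h1 h2
      exact h2.trans h1
    · filter_upwards [eventually_le_of_isLittleO hk
        (hlog1.mono fun n h => div_nonneg (Real.rpow_nonneg (Nat.cast_nonneg n) _)
          (zero_le_one.trans h)) one_pos, hlog1, hone] with n hn h1 h2
      rw [one_mul] at hn
      exact hn.trans ((div_le_self (Real.rpow_nonneg (Nat.cast_nonneg n) _) h1).trans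
        ((Real.rpow_le_rpow_of_exponent_le h2 (by linarith)).trans_eq (Real.rpow_one _)))
    · refine (isLittleO_logb_rpow h2α).trans_isBigO (IsBigO.of_bound 1 ?_)
      filter_upwards [hlow, hle] with n hn h1
      rw [one_mul, Real.norm_of_nonneg (Real.rpow_nonneg (Nat.cast_nonneg _) _), RCLike.norm_natCast]
      exact h1.trans hn.le
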